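/- Work in the real projective plane $\mathbb{RP}^2$ with its standard topology and smooth structure. A pseudoline is a simple smooth closed curve in $\mathbb{RP}^2$ that is isotopic to a projective line (that is, it is carried to it by a smooth isotopy of $\mathbb{RP}^2$). Let $\mathcal L=\{L_1,\dots,L_n\}$ be a simple arrangement of $n$ pseudolines: any two distinct pseudolines of $\mathcal L$ meet in exactly one point, they meet transversally there, and no three distinct ones have a common point. Suppose that $\binom{n-2}{2}$ is even (binomial coefficients $\binom{m}{2}$ with $m<2$ are $0$). For $L_i\neq L_j$ in $\mathcal L$, the complement $\mathbb{RP}^2\setminus(L_i\cup L_j)$ has exactly two connected components, the open digons of $L_i\cup L_j$; if $\alpha$ and $\beta$ are the numbers of crossings $L_s\cap L_t$ of distinct pseudolines $L_s\neq L_t$ in $\mathcal L\setminus\{L_i,L_j\}$ that lie in the first and in the second digon, then $\alpha+\beta=\binom{n-2}{2}$, and therefore $\alpha\equiv\beta\pmod 2$. Write $L_i\sim L_j$ if $L_i=L_j$ or if $L_i\neq L_j$ and $\alpha\equiv\binom{n-3}{2}\pmod 2$; this does not depend on the choice of the digon. Then $\sim$ is an equivalence relation on $\mathcal L$ with at most two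 classes. -/

import Mathlib

open scoped Manifold ContDiff LinearAlgebra.Projectivization

noncomputable section

namespace Pseudolines

/-- The real projective plane: the set of lines through the origin of `ℝ³`. -/
abbrev RP2 : Type := ℙ ℝ (Fin 3 → ℝ)

/-- The standard topology of the projective plane: the quotient topology from `ℝ³ ∖ {0}`. -/
instance instTopRP2 : TopologicalSpace RP2 :=
  inferInstanceAs (TopologicalSpace (Quotient (projectivizationSetoid ℝ (Fin 3 → ℝ))))

theorem isQuotientMap_mk' :
    Topology.IsQuotientMap (Projectivization.mk' ℝ : {v : Fin 3 → ℝ // v ≠ 0} → RP2) :=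
  isQuotientMap_quot_mk

/-- The affine coordinates in the `i`-th standard chart: `[v] ↦ (v_k / v_i)_{k ≠ i}`. -/
def affineCoord (i : Fin 3) : RP2 → (Fin 2 → ℝ) :=
  Projectivization.lift (fun v k => (v : Fin 3 → ℝ) (i.succAbove k) / (v : Fin 3 → ℝ) i) (by
    rintro ⟨a, ha⟩ ⟨b, hb⟩ t (rfl : a = t • b)
    have ht : t ≠ 0 := by
      rintro rfl
      simp at ha
    funext k
    simp [mul_div_mul_left _ _ ht])

/-- The domain of the `i`-th standard chart: the points whose `i`-th homogeneous coordinate is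
nonzero. -/
def chartDomain (i : Fin 3) : Set RP2 := {p | p.rep i ≠ 0}

theorem mk_mem_chartDomain (i : Fin 3) (v : Fin 3 → ℝ) (hv : v ≠ 0) :
    (Projectivization.mk ℝ v hv : RP2) ∈ chartDomain i ↔ v i ≠ 0 := by
  obtain ⟨a, ha⟩ := Projectivization.exists_smul_eq_mk_rep ℝ v hv
  show (Projectivization.mk ℝ v hv).rep i ≠ 0 ↔ _
  rw [← ha]
  simp [Units.smul_def]

theorem isOpen_chartDomain (i : Fin 3) : IsOpen (chartDomain i) := by
  rw [← isQuotientMap_mk'.isOpen_preimage]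
  have : (Projectivization.mk' ℝ : {v : Fin 3 → ℝ // v ≠ 0} → RP2) ⁻¹' chartDomain i
      = {v : {v : Fin 3 → ℝ // v ≠ 0} | v.1 i ≠ 0} := by
    ext ⟨v, hv⟩
    exact mk_mem_chartDomain i v hv
  rw [this]
  exact isOpen_ne_fun ((continuous_apply i).comp continuous_subtype_val) continuous_const

theorem insertNth_one_ne_zero (i : Fin 3) (w : Fin 2 → ℝ) :
    (i.insertNth (1 : ℝ) w : Fin 3 → ℝ) ≠ 0 := by
  intro h
  have := congrFun h i
  simp at this

/-- The inverse of the `i`-th affine coordinates. -/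
def affinePoint (i : Fin 3) (w : Fin 2 → ℝ) : RP2 :=
  Projectivization.mk ℝ (i.insertNth (1 : ℝ) w) (insertNth_one_ne_zero i w)

theorem continuous_insertNth_one (i : Fin 3) :
    Continuous fun w : Fin 2 → ℝ => (i.insertNth (1 : ℝ) w : Fin 3 → ℝ) := by
  refine continuous_pi fun k => ?_
  rcases Fin.eq_self_or_eq_succAbove i k with rfl | ⟨l, rfl⟩
  · simpa using continuous_const
  · simpa using continuous_apply l

/-- The `i`-th standard affine chart of the projective plane. -/
def affineChart (i : Fin 3) : OpenPartialHomeomorph RP2 (Fin 2 → ℝ) where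
  toFun := affineCoord i
  invFun := affinePoint i
  source := chartDomain i
  target := Set.univ
  map_source' _ _ := Set.mem_univ _
  map_target' w _ := by
    rw [affinePoint, mk_mem_chartDomain]
    simp
  left_inv' p hp := by
    induction p using Projectivization.ind with
    | h v hv =>
      rw [mk_mem_chartDomain] at hp
      rw [affinePoint, Projectivization.mk_eq_mk_iff']
      refine ⟨(v i)⁻¹, ?_⟩
      funext k
      rcases Fin.eq_self_or_eq_succAbove i k with rfl | ⟨l, rfl⟩
      · simp [hp]
      · simp [affineCoord, div_eq_inv_mul]
  right_inv' w _ := by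
    funext k
    simp [affinePoint, affineCoord]
  open_source := isOpen_chartDomain i
  open_target := isOpen_univ
  continuousOn_toFun := by
    refine (isQuotientMap_mk'.continuousOn_isOpen_iff (g := affineCoord i)
      (isOpen_chartDomain i)).2 ?_
    refine continuousOn_pi.2 fun k => ?_
    refine ContinuousOn.div (f := fun v : {v : Fin 3 → ℝ // v ≠ 0} => v.1 (i.succAbove k))
      (g := fun v : {v : Fin 3 → ℝ // v ≠ 0} => v.1 i)
      ((continuous_apply _).comp continuous_subtype_val).continuousOn
      ((continuous_apply _).comp continuous_subtype_val).continuousOn ?_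
    rintro ⟨v, hv⟩ h
    exact (mk_mem_chartDomain i v hv).1 h
  continuousOn_invFun := by
    have h : Continuous fun w : Fin 2 → ℝ =>
        (⟨i.insertNth (1 : ℝ) w, insertNth_one_ne_zero i w⟩ : {v : Fin 3 → ℝ // v ≠ 0}) :=
      (continuous_insertNth_one i).subtype_mk _
    exact (isQuotientMap_mk'.continuous.comp h).continuousOn

theorem exists_mem_chartDomain (p : RP2) : ∃ i, p ∈ chartDomain i := by
  by_contra! h
  exact p.rep_nonzero (funext fun i => not_not.1 (h i))

/-- The projective plane with its three standard affine charts. -/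
instance instChartedRP2 : ChartedSpace (Fin 2 → ℝ) RP2 where
  atlas := Set.range affineChart
  chartAt p := affineChart (exists_mem_chartDomain p).choose
  mem_chart_source p := (exists_mem_chartDomain p).choose_spec
  chart_mem_atlas _ := Set.mem_range_self _

/-- The projective plane is a smooth surface. -/
instance instIsManifoldRP2 : IsManifold 𝓘(ℝ, Fin 2 → ℝ) ∞ RP2 := by
  refine isManifold_of_contDiffOn _ _ _ ?_
  rintro _ _ ⟨i, rfl⟩ ⟨j, rfl⟩
  have hsm : ∀ k : Fin 3, ContDiff ℝ ∞
      fun w : Fin 2 → ℝ => (i.insertNth (1 : ℝ) w : Fin 3 → ℝ) k := by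
    intro k
    rcases Fin.eq_self_or_eq_succAbove i k with rfl | ⟨l, rfl⟩
    · simpa using contDiff_const
    · simpa using contDiff_apply ℝ ℝ l
  refine contDiffOn_pi.2 fun k => ?_
  refine ContDiffOn.div (f := fun w : Fin 2 → ℝ => (i.insertNth (1 : ℝ) w : Fin 3 → ℝ)
      (j.succAbove k)) (g := fun w : Fin 2 → ℝ => (i.insertNth (1 : ℝ) w : Fin 3 → ℝ) j)
    (hsm _).contDiffOn (hsm _).contDiffOn ?_
  intro w hw
  have h2 : affinePoint i w ∈ chartDomain j := hw.1.2
  exact (mk_mem_chartDomain j _ _).1 h2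

/-- A projective line: all points of the projective plane inside a plane of `ℝ³`. -/
def IsProjectiveLine (l : Set RP2) : Prop :=
  ∃ W : Submodule ℝ (Fin 3 → ℝ), Module.finrank ℝ W = 2 ∧ l = {p | p.submodule ≤ W}

/-- `L` is isotopic to `l`: there is a smooth family `Φ t`, `t ∈ [0, 1]`, of diffeomorphisms of
the projective plane which starts at the identity and ends with a diffeomorphism that carries
`l` onto `L`. -/
def IsIsotopic (l L : Set RP2) : Prop :=
  ∃ Φ : ℝ → (RP2 ≃ₘ^∞⟮𝓘(ℝ, Fin 2 → ℝ), 𝓘(ℝ, Fin 2 → ℝ)⟯ RP2),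
    ContMDiffOn (𝓘(ℝ, ℝ).prod 𝓘(ℝ, Fin 2 → ℝ)) 𝓘(ℝ, Fin 2 → ℝ) ∞
      (fun x : ℝ × RP2 => Φ x.1 x.2) (Set.Icc 0 1 ×ˢ Set.univ) ∧
    (∀ p, Φ 0 p = p) ∧ Φ 1 '' l = L

/-- A pseudoline: a curve isotopic to a projective line. (Being the image of a projective line
under a diffeomorphism, it is a simple smooth closed curve.) -/
def IsPseudoline (L : Set RP2) : Prop :=
  ∃ l, IsProjectiveLine l ∧ IsIsotopic l L

/-- The vectors tangent to `L` at `p`: velocities at `p` of smooth curves that run inside `L`. -/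
def tangentVectors (L : Set RP2) (p : RP2) : Set (TangentSpace 𝓘(ℝ, Fin 2 → ℝ) p) :=
  {v | ∃ c : ℝ → RP2, ContMDiff 𝓘(ℝ, ℝ) 𝓘(ℝ, Fin 2 → ℝ) ∞ c ∧ (∀ t, c t ∈ L) ∧
    ∃ h : c 0 = p, h ▸ (mfderiv 𝓘(ℝ, ℝ) 𝓘(ℝ, Fin 2 → ℝ) c 0 (1 : ℝ)) = v}

/-- `L` and `M` are transversal at `p`: their tangent vectors at `p` together span the tangent
plane. -/
def TransversalAt (L M : Set RP2) (p : RP2) : Prop :=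
  Submodule.span ℝ (tangentVectors L p ∪ tangentVectors M p) = ⊤

/-- A simple arrangement of pseudolines: a finite set of pseudolines, any two of which meet in
exactly one point, and transversally there, and no three of which have a common point. -/
structure IsSimpleArrangement (A : Finset (Set RP2)) : Prop where
  pseudoline : ∀ L ∈ A, IsPseudoline L
  meet_once : ∀ L ∈ A, ∀ M ∈ A, L ≠ M → ∃! p, p ∈ L ∩ M
  transversal : ∀ L ∈ A, ∀ M ∈ A, L ≠ M → ∀ p ∈ L ∩ M, TransversalAt L M p
  no_triple : ∀ L ∈ A, ∀ M ∈ A, ∀ N ∈ A, L ≠ M → L ≠ N → M ≠ N → L ∩ M ∩ N = ∅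

/-- The digons of `L ∪ M`: the connected components of its complement. -/
def digons (L M : Set RP2) : Set (Set RP2) :=
  {D | ∃ p ∈ (L ∪ M)ᶜ, D = connectedComponentIn (L ∪ M)ᶜ p}

/-- The number of crossings `S ∩ T` of two distinct pseudolines of `A ∖ {L, M}` that lie in
the region `D`. -/
def crossings (A : Finset (Set RP2)) (L M D : Set RP2) : ℕ :=
  {p : RP2 | p ∈ D ∧ ∃ S ∈ A, ∃ T ∈ A, S ≠ T ∧ S ≠ L ∧ S ≠ M ∧ T ≠ L ∧ T ≠ M ∧
    p ∈ S ∩ T}.ncard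

/-- The relation `L ∼ M` on the arrangement `A` of `n` pseudolines: either `L = M`, or a digon
of `L ∪ M` contains a number of crossings congruent to `(n - 3).choose 2` modulo 2. -/
def Related (A : Finset (Set RP2)) (L M : {L : Set RP2 // L ∈ A}) : Prop :=
  L = M ∨ ∃ D ∈ digons (L : Set RP2) M,
    crossings A L M D ≡ (A.card - 3).choose 2 [MOD 2]

end Pseudolines

end

/-! Lift each pseudoline to the sphere, the double cover of the plane. An isotopy lifts to an odd
homeomorphism, so every pseudoline $L$ becomes the zero set of an odd continuous function $f_L$,
namely a linear form composed with a homeomorphism. The two digons of $L \cup M$ are then the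
regions $f_L f_M < 0$ and $f_L f_M > 0$, whose signs are well defined downstairs by oddness
(`IsEquation.digons_eq`). Their connectedness is the topological core
(`IsEquation.isPreconnected_pos_pos`).

Let $\varepsilon(L,M) \in \mathbb{Z}/2$ count the crossings of the other pseudolines in the region
$f_L f_M < 0$. For distinct $L, M, N$ add up the three values $\varepsilon$. A crossing off $L \cup
M \cup N$ contributes $0$, because the product of the three pairwise sign products is positive
(`IsEquation.oppositeSign_cocycle`). Each further pseudoline $S$ meets $L, M, N$ in three points,
which together contribute $1$ (`IsEquation.oppositeSign_sum_eq_one`). Hence the sum is $n-3$ modulo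
$2$ (`IsCrossingMap.crossingParity_add`).

As $\binom{n-2}{2} = (n-3) + \binom{n-3}{2}$ is even, the sum equals $w = \binom{n-3}{2}$ modulo
$2$. If two of the three values are $w$, so is the third: this is transitivity. If none were $w$,
the sum would be $w+1$: so among three pseudolines two are related, and there are at most two
classes. -/

namespace Pseudolines

open Topology

/-! ### The sphere as a double cover of the projective plane. -/

/-- The unit sphere of `ℝ³` for the supremum norm, a double cover of the projective plane. -/
abbrev Sphere : Type := Metric.sphere (0 : Fin 3 → ℝ) 1

theorem Sphere.coe_ne_zero (x : Sphere) : (x : Fin 3 → ℝ) ≠ 0 :=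
  ne_zero_of_mem_unit_sphere x

/-- The covering map from the sphere to the projective plane. -/
noncomputable def toRP2 (x : Sphere) : RP2 :=
  Projectivization.mk ℝ (x : Fin 3 → ℝ) x.coe_ne_zero

/-- The radial projection of `ℝ³ ∖ {0}` onto the sphere. -/
noncomputable def radial (v : {v : Fin 3 → ℝ // v ≠ 0}) : Sphere :=
  ⟨‖v.1‖⁻¹ • v.1, by
    have h : ‖v.1‖ ≠ 0 := norm_ne_zero_iff.2 v.2
    simp [norm_smul, h]⟩

theorem coe_radial (v : {v : Fin 3 → ℝ // v ≠ 0}) :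
    (radial v : Fin 3 → ℝ) = ‖v.1‖⁻¹ • v.1 := rfl

theorem continuous_radial : Continuous radial := by
  have h : Continuous fun v : {v : Fin 3 → ℝ // v ≠ 0} => ‖v.1‖⁻¹ • v.1 :=
    (continuous_subtype_val.norm.inv₀ fun v => norm_ne_zero_iff.2 v.2).smul continuous_subtype_val
  exact h.subtype_mk _

theorem radial_coe (x : Sphere) : radial ⟨x, x.coe_ne_zero⟩ = x := by
  ext1
  simp [coe_radial]

theorem toRP2_radial (v : {v : Fin 3 → ℝ // v ≠ 0}) :
    toRP2 (radial v) = Projectivization.mk' ℝ v := by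
  rw [toRP2, Projectivization.mk'_eq_mk, Projectivization.mk_eq_mk_iff']
  exact ⟨‖v.1‖⁻¹, rfl⟩

theorem toRP2_surjective : Function.Surjective toRP2 := by
  intro p
  refine ⟨radial ⟨p.rep, p.rep_nonzero⟩, ?_⟩
  rw [toRP2_radial, Projectivization.mk'_eq_mk, Projectivization.mk_rep]

theorem continuous_toRP2 : Continuous toRP2 :=
  isQuotientMap_mk'.continuous.comp
    (Continuous.subtype_mk continuous_subtype_val Sphere.coe_ne_zero)

/-- The defining quotient map from $\mathbb{R}^3 \setminus 0$ factors as `toRP2 ∘ radial`. -/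
theorem isQuotientMap_toRP2 : IsQuotientMap toRP2 := by
  refine IsQuotientMap.of_comp continuous_radial continuous_toRP2 ?_
  convert isQuotientMap_mk' using 1
  exact funext toRP2_radial

theorem toRP2_eq_iff {x y : Sphere} : toRP2 x = toRP2 y ↔ x = y ∨ x = -y := by
  rw [toRP2, toRP2, Projectivization.mk_eq_mk_iff']
  constructor
  · rintro ⟨a, ha⟩
    have h := congrArg norm ha
    rw [norm_smul, norm_eq_of_mem_sphere, norm_eq_of_mem_sphere, mul_one, Real.norm_eq_abs] at h
    rcases eq_or_eq_neg_of_abs_eq h with rfl | rfl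
    · left; ext1; simpa using ha.symm
    · right; ext1; simpa using ha.symm
  · rintro (rfl | rfl)
    · exact ⟨1, by simp⟩
    · exact ⟨-1, by simp⟩

@[simp] theorem toRP2_neg (x : Sphere) : toRP2 (-x) = toRP2 x :=
  toRP2_eq_iff.2 (Or.inr rfl)

theorem Sphere.neg_ne (x : Sphere) : -x ≠ x := fun h => by
  have h1 : -(x : Fin 3 → ℝ) = x := congrArg Subtype.val h
  exact x.coe_ne_zero (neg_eq_self.1 h1)

/-- The action of `±1` on the sphere. -/
instance instSignActionSphere : MulAction ℤˣ Sphere where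
  smul u x := if u = 1 then x else -x
  one_smul x := if_pos rfl
  mul_smul u w x := by
    rcases Int.units_eq_one_or u with rfl | rfl <;> rcases Int.units_eq_one_or w with rfl | rfl
    all_goals
      show (if _ then x else -x) = if _ then (if _ then x else -x) else -(if _ then x else -x)
      simp

theorem isQuotientCoveringMap_toRP2 : IsQuotientCoveringMap toRP2 ℤˣ where
  toIsQuotientMap := isQuotientMap_toRP2
  continuous_const_smul u := by
    rcases Int.units_eq_one_or u with rfl | rfl
    · simpa using continuous_id'
    · exact continuous_neg
  apply_eq_iff_mem_orbit {x y} := by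
    rw [toRP2_eq_iff]
    constructor
    · rintro (rfl | rfl)
      · exact ⟨1, one_smul _ _⟩
      · exact ⟨-1, rfl⟩
    · rintro ⟨u, rfl⟩
      rcases Int.units_eq_one_or u with rfl | rfl
      · exact Or.inl (one_smul _ _)
      · exact Or.inr rfl
  disjoint x := by
    refine ⟨Metric.ball x 1, Metric.ball_mem_nhds x one_pos, fun u hu => ?_⟩
    rcases Int.units_eq_one_or u with rfl | rfl
    · rfl
    · obtain ⟨_, ⟨y, hy, rfl⟩, hz⟩ := hu
      exfalso
      change -y ∈ Metric.ball x 1 at hz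
      -- Antipodes are at distance exactly $2$, so a unit ball cannot meet its antipodal image.
      have h : dist (-y) y < 2 := by
        linarith [dist_triangle_right (-y) y x, Metric.mem_ball.1 hy, Metric.mem_ball.1 hz]
      have h2 : dist (-y) y = 2 := by
        show dist (-(y : Fin 3 → ℝ)) y = 2
        rw [dist_eq_norm, ← neg_add', norm_neg, ← two_smul ℝ (y : Fin 3 → ℝ), norm_smul,
          norm_eq_of_mem_sphere]
        simp
      linarith

theorem isCoveringMap_toRP2 : IsCoveringMap toRP2 :=
  isQuotientCoveringMap_toRP2.isCoveringMap

/-! ### Lifting isotopies to the sphere. -/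

/-- The end map of an isotopy of the projective plane lifts to an odd homeomorphism of the
sphere. -/
theorem exists_odd_homeomorph_lift
    (Φ : ℝ → (RP2 ≃ₘ^∞⟮𝓘(ℝ, Fin 2 → ℝ), 𝓘(ℝ, Fin 2 → ℝ)⟯ RP2))
    (hΦ : ContMDiffOn (𝓘(ℝ, ℝ).prod 𝓘(ℝ, Fin 2 → ℝ)) 𝓘(ℝ, Fin 2 → ℝ) ∞
      (fun x : ℝ × RP2 => Φ x.1 x.2) (Set.Icc 0 1 ×ˢ Set.univ))
    (h0 : ∀ p, Φ 0 p = p) :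
    ∃ φ : Sphere ≃ₜ Sphere, (∀ x, φ (-x) = -φ x) ∧ ∀ x, toRP2 (φ x) = Φ 1 (toRP2 x) := by
  have hc : Continuous fun x : unitInterval × Sphere => Φ x.1 (toRP2 x.2) :=
    hΦ.continuousOn.comp_continuous (f := fun x : unitInterval × Sphere => ((x.1 : ℝ), toRP2 x.2))
      ((continuous_subtype_val.comp continuous_fst).prodMk (continuous_toRP2.comp continuous_snd))
      fun x => ⟨x.1.2, Set.mem_univ _⟩
  let H : C(unitInterval × Sphere, RP2) := ⟨_, hc⟩
  have H0 : ∀ x, H (0, x) = toRP2 (ContinuousMap.id Sphere x) := fun x => h0 _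
  let F := isCoveringMap_toRP2.liftHomotopy H (ContinuousMap.id Sphere) H0
  have hF : ∀ t x, toRP2 (F (t, x)) = Φ t (toRP2 x) := fun t x =>
    congrFun (isCoveringMap_toRP2.liftHomotopy_lifts H (ContinuousMap.id Sphere) H0) (t, x)
  have hF0 : ∀ x, F (0, x) = x :=
    isCoveringMap_toRP2.liftHomotopy_zero H (ContinuousMap.id Sphere) H0
  -- Both sides lift the same homotopy and start at the identity, so uniqueness of lifts applies.
  have hodd : ∀ t x, -F (t, -x) = F (t, x) := by
    intro t x
    refine congrFun ((isCoveringMap_toRP2.eq_liftHomotopy_iff H0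
      (fun y => -F (y.1, -y.2))).2 ⟨?_, ?_, ?_⟩) (t, x)
    · intro a
      fun_prop
    · ext ⟨s, y⟩
      simp only [Function.comp, toRP2_neg, hF]
      rfl
    · intro a
      simp [hF0]
  have hodd' : ∀ x, F (1, -x) = -F (1, x) := fun x => by rw [← hodd 1 x, neg_neg]
  have hbij : Function.Bijective fun x => F (1, x) := by
    constructor
    · intro x y hxy
      have h := congrArg toRP2 hxy
      simp only [hF] at h
      rcases toRP2_eq_iff.1 ((Φ _).injective h) with h | rfl
      · exact h
      · simp only [hodd'] at hxy
        exact absurd hxy (Sphere.neg_ne _)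
    · intro y
      obtain ⟨x, hx⟩ := toRP2_surjective ((Φ 1).symm (toRP2 y))
      have h : toRP2 (F (1, x)) = toRP2 y := by
        rw [hF, hx]
        exact (Φ 1).apply_symm_apply _
      rcases toRP2_eq_iff.1 h with h | h
      · exact ⟨x, h⟩
      · exact ⟨-x, by simp [hodd', h]⟩
  have hcont : Continuous (Equiv.ofBijective _ hbij) := by
    show Continuous fun x => F (1, x)
    fun_prop
  exact ⟨hcont.homeoOfEquivCompactToT2, hodd', hF 1⟩

/-! ### Equations of pseudolines. -/

/-- The preimage in the sphere of the curve `L` is the zero set of the odd function `f`, is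
parametrized by `c`, with antipodal points at parameter distance `π`, and is locally flat and
has a connected side. -/
structure IsEquation (L : Set RP2) (f : Sphere → ℝ) (c : ℝ → Sphere) : Prop where
  continuous : Continuous f
  odd : ∀ x, f (-x) = -f x
  mem_iff : ∀ x, toRP2 x ∈ L ↔ f x = 0
  isPreconnected_pos : IsPreconnected {x | 0 < f x}
  exists_nhds : ∀ x, f x = 0 → ∀ U ∈ 𝓝 x, ∃ V ∈ 𝓝 x, V ⊆ U ∧
    IsPreconnected (V ∩ {y | 0 < f y}) ∧ (V ∩ {y | 0 < f y}).Nonempty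
  continuous_curve : Continuous c
  curve_add_pi : ∀ t, c (t + Real.pi) = -c t
  apply_curve : ∀ t, f (c t) = 0
  exists_curve_eq : ∀ x, f x = 0 → ∃ t, c t = x
  curve_inj : ∀ s t, |s - t| < Real.pi → toRP2 (c s) = toRP2 (c t) → s = t

/-- An equation is transported by a homeomorphism. -/
theorem IsEquation.map {l L : Set RP2} {f : Sphere → ℝ} {c : ℝ → Sphere} (h : IsEquation l f c)
    (φ : Sphere ≃ₜ Sphere) (hφ : ∀ x, φ (-x) = -φ x)
    (hL : ∀ x, toRP2 (φ x) ∈ L ↔ toRP2 x ∈ l) :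
    IsEquation L (f ∘ φ.symm) (φ ∘ c) := by
  have hφ' : ∀ x, φ.symm (-x) = -φ.symm x := fun x => by
    rw [φ.symm_apply_eq, hφ, φ.apply_symm_apply]
  have himg : ∀ V : Set Sphere, (φ '' V) ∩ {y | 0 < (f ∘ φ.symm) y} =
      φ '' (V ∩ {y | 0 < f y}) := by
    intro V
    ext y
    obtain ⟨x, rfl⟩ := φ.surjective y
    simp
  constructor
  · exact h.continuous.comp φ.symm.continuous
  · intro x
    simp [hφ', h.odd]
  · intro x
    rw [← φ.apply_symm_apply x, hL, h.mem_iff]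
    simp
  · have := h.isPreconnected_pos.image φ φ.continuous.continuousOn
    convert this using 1
    simpa using himg Set.univ
  · intro x hx U hU
    have hU' : φ ⁻¹' U ∈ 𝓝 (φ.symm x) :=
      φ.continuous.continuousAt.preimage_mem_nhds (by simpa using hU)
    obtain ⟨V, hV, hVU, hc, hne⟩ := h.exists_nhds _ hx _ hU'
    refine ⟨φ '' V, ?_, Set.image_subset_iff.2 hVU, ?_, ?_⟩
    · have := φ.isOpenMap.image_mem_nhds hV
      simpa using this
    · rw [himg]
      exact hc.image φ φ.continuous.continuousOn
    · rw [himg]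
      exact hne.image φ
  · exact φ.continuous.comp h.continuous_curve
  · intro t
    simp [h.curve_add_pi, hφ]
  · intro t
    simp [h.apply_curve]
  · intro x hx
    obtain ⟨t, ht⟩ := h.exists_curve_eq _ hx
    exact ⟨t, by simp [ht]⟩
  · intro s t hst he
    refine h.curve_inj s t hst ?_
    rw [toRP2_eq_iff] at he ⊢
    simpa [← hφ] using he

theorem radial_eq_of_smul {r : ℝ} (hr : 0 < r) (x : Sphere) (v : {v : Fin 3 → ℝ // v ≠ 0})
    (hv : v.1 = r • (x : Fin 3 → ℝ)) : radial v = x := by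
  ext1
  rw [coe_radial, hv, norm_smul, norm_eq_of_mem_sphere, mul_one, smul_smul, Real.norm_eq_abs,
    abs_of_pos hr, inv_mul_cancel₀ hr.ne', one_smul]

/-- The set is the image of $C$ under radial projection. It transfers connectedness of convex sets
to the sphere. -/
theorem isPreconnected_cone {C : Set (Fin 3 → ℝ)} (hC : IsPreconnected C)
    (h0 : ∀ v ∈ C, v ≠ 0) :
    IsPreconnected {x : Sphere | ∃ r : ℝ, 0 < r ∧ r • (x : Fin 3 → ℝ) ∈ C} := by
  have h1 : IsPreconnected ((↑) ⁻¹' C : Set {v : Fin 3 → ℝ // v ≠ 0}) := by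
    have hi : IsInducing (Subtype.val : {v : Fin 3 → ℝ // v ≠ 0} → Fin 3 → ℝ) :=
      IsInducing.subtypeVal
    rw [← hi.isPreconnected_image, Set.image_preimage_eq_of_subset]
    · exact hC
    · exact fun v hv => ⟨⟨v, h0 v hv⟩, rfl⟩
  convert h1.image radial continuous_radial.continuousOn using 1
  ext x
  constructor
  · rintro ⟨r, hr, hx⟩
    exact ⟨⟨_, h0 _ hx⟩, hx, radial_eq_of_smul hr x _ rfl⟩
  · rintro ⟨v, hv, rfl⟩
    have hn : 0 < ‖v.1‖ := norm_pos_iff.2 v.2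
    refine ⟨‖v.1‖, hn, ?_⟩
    rw [coe_radial, smul_smul, mul_inv_cancel₀ hn.ne', one_smul]
    exact hv

/-- A linear form is an equation of the projective line on which it vanishes. -/
theorem exists_isEquation_of_isProjectiveLine {l : Set RP2} (hl : IsProjectiveLine l) :
    ∃ f c, IsEquation l f c := by
  obtain ⟨W, hW, rfl⟩ := hl
  have hlt : W < ⊤ := lt_top_iff_ne_top.2 fun h => by
    rw [h, finrank_top] at hW
    simp at hW
  obtain ⟨g, hg0, hgW⟩ := Submodule.exists_le_ker_of_lt_top W hlt
  have hker : LinearMap.ker g = W := by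
    refine (Submodule.eq_of_le_of_finrank_le hgW ?_).symm
    have h2 := Submodule.finrank_lt fun h => hg0 (LinearMap.ker_eq_top.1 h)
    simp at h2
    omega
  have hmem : ∀ v, v ∈ W ↔ g v = 0 := fun v => by rw [← hker, LinearMap.mem_ker]
  have hgc : Continuous g := g.continuous_of_finiteDimensional
  have hconv : Convex ℝ {v | 0 < g v} := convex_halfSpace_gt g.isLinear 0
  have hpos : ∀ (r : ℝ), 0 < r → ∀ v, 0 < g (r • v) ↔ 0 < g v := fun r hr v => by
    rw [map_smul, smul_eq_mul, mul_pos_iff_of_pos_left hr]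
  let b := Module.finBasisOfFinrankEq ℝ W hW
  let q : ℝ → ℝ → Fin 3 → ℝ := fun x y => (x • b 0 + y • b 1 : W)
  have hqW : ∀ x y, q x y ∈ W := fun x y => Subtype.coe_prop _
  have hq : ∀ x y x' y', q x y = q x' y' → x = x' ∧ y = y' := by
    intro x y x' y' h
    have h1 : (x • b 0 + y • b 1 : W) = x' • b 0 + y' • b 1 := Subtype.ext h
    have h2 := congrArg b.repr h1
    constructor
    · simpa using DFunLike.congr_fun h2 0
    · simpa using DFunLike.congr_fun h2 1
  have hqs : ∀ r x y, r • q x y = q (r * x) (r * y) := by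
    intro r x y
    simp [q, mul_smul]
  have hqsurj : ∀ v ∈ W, ∃ x y, v = q x y := by
    intro v hv
    refine ⟨b.repr ⟨v, hv⟩ 0, b.repr ⟨v, hv⟩ 1, ?_⟩
    have h := b.sum_repr ⟨v, hv⟩
    rw [Fin.sum_univ_two] at h
    exact (congrArg Subtype.val h).symm
  have hq0 : q 0 0 = 0 := by simp [q]
  have hcs : ∀ t : ℝ, q (Real.cos t) (Real.sin t) ≠ 0 := by
    intro t h
    rw [← hq0] at h
    obtain ⟨h1, h2⟩ := hq _ _ _ _ h
    have := Real.sin_sq_add_cos_sq t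
    rw [h1, h2] at this
    norm_num at this
  let c : ℝ → Sphere := fun t => radial ⟨q (Real.cos t) (Real.sin t), hcs t⟩
  have hcW : ∀ t, (c t : Fin 3 → ℝ) ∈ W := fun t => W.smul_mem _ (hqW _ _)
  refine ⟨fun x => g x, c, ?_⟩
  constructor
  · exact hgc.comp continuous_subtype_val
  · intro x
    simp
  · intro x
    rw [← hmem]
    simp [toRP2, Projectivization.submodule_mk]
  · convert isPreconnected_cone hconv.isPreconnected ?_ using 1
    · ext x
      constructor
      · intro hx
        exact ⟨1, one_pos, (hpos 1 one_pos _).2 hx⟩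
      · rintro ⟨r, hr, hx⟩
        exact (hpos r hr _).1 hx
    · rintro v hv rfl
      simp at hv
  · intro x hx U hU
    have hU' : radial ⁻¹' U ∈ 𝓝 (⟨x, x.coe_ne_zero⟩ : {v : Fin 3 → ℝ // v ≠ 0}) :=
      continuous_radial.continuousAt.preimage_mem_nhds (by rwa [radial_coe])
    obtain ⟨δ, hδ, hδU⟩ := Metric.mem_nhds_iff.1 hU'
    -- The bound $1 = \|x\|$ keeps the ball away from the origin. The neighbourhood $V$ is the
    -- radial projection of this ball, and its positive part that of a convex half-ball.
    let ε := min δ 1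
    have hε : 0 < ε := lt_min hδ one_pos
    have hball0 : ∀ v ∈ Metric.ball (x : Fin 3 → ℝ) ε, v ≠ 0 := by
      rintro v hv rfl
      rw [Metric.mem_ball, dist_zero_left, norm_eq_of_mem_sphere] at hv
      exact absurd hv (not_lt.2 (min_le_right _ _))
    refine ⟨{y | ∃ r : ℝ, 0 < r ∧ r • (y : Fin 3 → ℝ) ∈ Metric.ball (x : Fin 3 → ℝ) ε},
      ?_, ?_, ?_, ?_⟩
    · refine Filter.mem_of_superset (Metric.ball_mem_nhds x hε) fun y hy => ?_
      exact ⟨1, one_pos, by simpa [Subtype.dist_eq] using hy⟩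
    · rintro y ⟨r, hr, hy⟩
      have h := @hδU ⟨_, hball0 _ hy⟩ (lt_of_lt_of_le (Metric.mem_ball.1 hy) (min_le_left _ _))
      rwa [Set.mem_preimage, radial_eq_of_smul hr y _ rfl] at h
    · convert isPreconnected_cone
        (((convex_ball (x : Fin 3 → ℝ) ε).inter hconv).isPreconnected) ?_ using 1
      · ext y
        constructor
        · rintro ⟨⟨r, hr, hy⟩, hy'⟩
          exact ⟨r, hr, hy, (hpos r hr _).2 hy'⟩
        · rintro ⟨r, hr, hy, hy'⟩
          exact ⟨⟨r, hr, hy⟩, (hpos r hr _).1 hy'⟩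
      · exact fun v hv => hball0 v hv.1
    · obtain ⟨v, hv⟩ : ∃ v, 0 < g v := by
        obtain ⟨v, hv⟩ : ∃ v, g v ≠ 0 := by
          by_contra! h
          exact hg0 (LinearMap.ext h)
        rcases lt_or_gt_of_ne hv with hv | hv
        · exact ⟨-v, by simpa using hv⟩
        · exact ⟨v, hv⟩
      -- A small push from $x$ towards $v$ stays in the ball and makes $g$ positive.
      have hcont : Filter.Tendsto (fun s : ℝ => (x : Fin 3 → ℝ) + s • v) (𝓝[>] 0)
          (𝓝 (x : Fin 3 → ℝ)) := by
        have : Continuous (fun s : ℝ => (x : Fin 3 → ℝ) + s • v) := by fun_prop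
        simpa using (this.tendsto 0).mono_left nhdsWithin_le_nhds
      obtain ⟨s, hs, hs0⟩ := ((hcont.eventually (Metric.ball_mem_nhds _ hε)).and
        self_mem_nhdsWithin).exists
      have hn := hball0 _ hs
      have hn' : 0 < ‖(x : Fin 3 → ℝ) + s • v‖ := norm_pos_iff.2 hn
      have hgs : 0 < g ((x : Fin 3 → ℝ) + s • v) := by
        rw [map_add, map_smul, hx, zero_add]
        exact mul_pos hs0 hv
      refine ⟨radial ⟨_, hn⟩, ⟨_, hn', ?_⟩, (hpos _ (inv_pos.2 hn') _).2 hgs⟩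
      rw [coe_radial, smul_smul, mul_inv_cancel₀ hn'.ne', one_smul]
      exact hs
  · refine continuous_radial.comp (Continuous.subtype_mk ?_ _)
    show Continuous fun t => ((Real.cos t • b 0 + Real.sin t • b 1 : W) : Fin 3 → ℝ)
    fun_prop
  · intro t
    ext1
    have h : q (Real.cos (t + Real.pi)) (Real.sin (t + Real.pi)) =
        -q (Real.cos t) (Real.sin t) := by
      rw [← neg_one_smul ℝ (q _ _), hqs, Real.cos_add_pi, Real.sin_add_pi]
      simp
    show ‖_‖⁻¹ • _ = -(‖_‖⁻¹ • _)
    simp only [h, norm_neg, smul_neg]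
  · exact fun t => (hmem _).1 (hcW t)
  · intro x hx
    obtain ⟨a, d, had⟩ := hqsurj _ ((hmem _).2 hx)
    -- Polar coordinates in the plane $W$: the parameter of $x$ is the argument of $a + id$.
    let z : ℂ := ⟨a, d⟩
    have hz : z ≠ 0 := by
      intro h
      have h1 : a = 0 := congrArg Complex.re h
      have h2 : d = 0 := congrArg Complex.im h
      rw [h1, h2, hq0] at had
      exact x.coe_ne_zero had
    have hz' : 0 < ‖z‖ := norm_pos_iff.2 hz
    refine ⟨z.arg, radial_eq_of_smul (inv_pos.2 hz') x _ ?_⟩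
    show q _ _ = _
    rw [Complex.cos_arg hz, Complex.sin_arg, had, hqs, div_eq_inv_mul, div_eq_inv_mul]
  · intro s t hst he
    obtain ⟨k, hk⟩ : ∃ k : ℝ, q (Real.cos s) (Real.sin s) =
        k • q (Real.cos t) (Real.sin t) := by
      rw [toRP2_radial, toRP2_radial, Projectivization.mk'_eq_mk, Projectivization.mk'_eq_mk,
        Projectivization.mk_eq_mk_iff'] at he
      exact he.imp fun _ h => h.symm
    rw [hqs] at hk
    obtain ⟨h1, h2⟩ := hq _ _ _ _ hk
    have h3 : Real.sin (s - t) = 0 := by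
      rw [Real.sin_sub, h1, h2]
      ring
    have h4 := (Real.sin_eq_zero_iff_of_lt_of_lt (abs_lt.1 hst).1 (abs_lt.1 hst).2).1 h3
    linarith

/-- Every pseudoline has an equation. -/
theorem IsPseudoline.exists_isEquation {L : Set RP2} (hL : IsPseudoline L) :
    ∃ f c, IsEquation L f c := by
  obtain ⟨l, hl, Φ, hΦ, h0, rfl⟩ := hL
  obtain ⟨φ, hodd, hφ⟩ := exists_odd_homeomorph_lift Φ hΦ h0
  obtain ⟨f, c, h⟩ := exists_isEquation_of_isProjectiveLine hl
  refine ⟨_, _, h.map φ hodd fun x => ?_⟩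
  rw [hφ]
  exact (Φ 1).injective.mem_set_image

/-! ### Signs along curves and connectedness of the regions. -/

theorem mul_pos_of_forall_ne_zero {F : ℝ → ℝ} (hF : Continuous F) {a b : ℝ} (hab : a ≤ b)
    (h : ∀ t ∈ Set.Icc a b, F t ≠ 0) : 0 < F a * F b := by
  have ha := h a (Set.left_mem_Icc.2 hab)
  have hb := h b (Set.right_mem_Icc.2 hab)
  by_contra hn
  have hz : (0 : ℝ) ∈ F '' Set.Icc a b := by
    rcases lt_or_gt_of_ne ha with ha' | ha' <;> rcases lt_or_gt_of_ne hb with hb' | hb'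
    · exact absurd (mul_pos_of_neg_of_neg ha' hb') hn
    · exact intermediate_value_Icc hab hF.continuousOn ⟨ha'.le, hb'.le⟩
    · exact intermediate_value_Icc' hab hF.continuousOn ⟨hb'.le, ha'.le⟩
    · exact absurd (mul_pos ha' hb') hn
  obtain ⟨t, ht, h0⟩ := hz
  exact h t ht h0

namespace IsEquation

variable {L M N S : Set RP2} {f g k h : Sphere → ℝ} {c d e : ℝ → Sphere}

/-- The equation with the opposite sign. -/
theorem neg (hf : IsEquation L f c) : IsEquation L (fun x => -f x) (fun t => -c t) := by
  -- The antipodal map preserves the preimage of $L$, and composing with it negates the odd function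
  -- $f$.
  have := hf.map (L := L) (Homeomorph.neg Sphere) (fun x => rfl) (fun x => by
    rw [Homeomorph.coe_neg, toRP2_neg])
  convert this using 1
  · ext x
    exact (hf.odd x).symm
  · rfl

/-- Up to sign, every point of the curve has a parameter in a given interval of length `π`. -/
theorem exists_mem_Ico (hf : IsEquation L f c) (x : Sphere) (hx : f x = 0) (a : ℝ) :
    ∃ t ∈ Set.Ico a (a + Real.pi), x = c t ∨ x = -c t := by
  obtain ⟨s, rfl⟩ := hf.exists_curve_eq x hx
  have hanti : Function.Antiperiodic c Real.pi := hf.curve_add_pi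
  obtain ⟨t, ht, hst⟩ := hanti.periodic_two_mul.exists_mem_Ico Real.two_pi_pos s a
  rcases lt_or_ge t (a + Real.pi) with h | h
  · exact ⟨t, ⟨ht.1, h⟩, Or.inl hst⟩
  · refine ⟨t - Real.pi, ⟨by linarith, by linarith [ht.2]⟩, Or.inr ?_⟩
    rw [← hf.curve_add_pi, sub_add_cancel, hst]

theorem toRP2_eq_of_meet (hf : IsEquation L f c) (hg : IsEquation M g d)
    (hLM : ∃! p, p ∈ L ∩ M) {x y : Sphere} (hx : f x = 0) (hx' : g x = 0)
    (hy : f y = 0) (hy' : g y = 0) : toRP2 x = toRP2 y :=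
  hLM.unique ⟨(hf.mem_iff x).2 hx, (hg.mem_iff x).2 hx'⟩
    ⟨(hf.mem_iff y).2 hy, (hg.mem_iff y).2 hy'⟩

/-- Every zero of $f$ along the second curve lies over the unique crossing, and the parameter of
that point is unique modulo $\pi$. -/
theorem apply_curve_ne_zero (hf : IsEquation L f c) (hg : IsEquation M g d)
    (hLM : ∃! p, p ∈ L ∩ M) {s t : ℝ} (hs : f (d s) = 0) (hst : s ≠ t) (hd : |s - t| < Real.pi) :
    f (d t) ≠ 0 := fun ht =>
  hst (hg.curve_inj s t hd
    (toRP2_eq_of_meet hf hg hLM hs (hg.apply_curve s) ht (hg.apply_curve t)))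

theorem exists_apply_curve_eq_zero (hf : IsEquation L f c) (hg : IsEquation M g d)
    (hLM : ∃! p, p ∈ L ∩ M) : ∃ t, f (d t) = 0 := by
  obtain ⟨p, ⟨hpL, hpM⟩, -⟩ := hLM
  obtain ⟨x, rfl⟩ := toRP2_surjective p
  obtain ⟨t, rfl⟩ := hg.exists_curve_eq x ((hg.mem_iff x).1 hpM)
  exact ⟨t, (hf.mem_iff _).1 hpL⟩

/-- The part of a pseudoline on one side of another one is an open arc. -/
theorem isPreconnected_arc (hf : IsEquation L f c) (hg : IsEquation M g d)
    (hLM : ∃! p, p ∈ L ∩ M) :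
    IsPreconnected {x | 0 < f x ∧ g x = 0} ∧ {x | 0 < f x ∧ g x = 0}.Nonempty := by
  have hπ := Real.pi_pos
  have hcont : Continuous fun t => f (d t) := hf.continuous.comp hg.continuous_curve
  -- Shifting $a$ by $\pi$ flips the sign of $f$ at the midpoint, so that sign may be chosen.
  obtain ⟨a, ha, hmid⟩ : ∃ a, f (d a) = 0 ∧ 0 < f (d (a + Real.pi / 2)) := by
    obtain ⟨a, ha⟩ := exists_apply_curve_eq_zero hf hg hLM
    have hne : f (d (a + Real.pi / 2)) ≠ 0 := apply_curve_ne_zero hf hg hLM ha (by linarith)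
      (by rw [sub_add_cancel_left, abs_neg, abs_of_pos (by linarith)]; linarith)
    rcases lt_or_gt_of_ne hne with h | h
    · refine ⟨a + Real.pi, by rw [hg.curve_add_pi, hf.odd, ha, neg_zero], ?_⟩
      rw [add_right_comm, hg.curve_add_pi, hf.odd]
      linarith
    · exact ⟨a, ha, h⟩
  have hpos : ∀ t ∈ Set.Ioo a (a + Real.pi), 0 < f (d t) := by
    intro t ht
    have hne : ∀ s ∈ Set.Ioo a (a + Real.pi), f (d s) ≠ 0 := fun s hs =>
      apply_curve_ne_zero hf hg hLM ha hs.1.ne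
        (by rw [abs_sub_comm, abs_of_pos (by linarith [hs.1])]; linarith [hs.2])
    have hm : a + Real.pi / 2 ∈ Set.Ioo a (a + Real.pi) := ⟨by linarith, by linarith⟩
    rcases le_total t (a + Real.pi / 2) with h | h
    · exact pos_of_mul_pos_left (mul_pos_of_forall_ne_zero hcont h fun s hs =>
        hne s ⟨ht.1.trans_le hs.1, hs.2.trans_lt hm.2⟩) hmid.le
    · exact pos_of_mul_pos_right (mul_pos_of_forall_ne_zero hcont h fun s hs =>
        hne s ⟨hm.1.trans_le hs.1, hs.2.trans_lt ht.2⟩) hmid.le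
  have himg : {x | 0 < f x ∧ g x = 0} = d '' Set.Ioo a (a + Real.pi) := by
    ext x
    constructor
    · rintro ⟨hx, hx'⟩
      obtain ⟨t, ht, h⟩ := hg.exists_mem_Ico x hx' a
      have hta : a < t := lt_of_le_of_ne ht.1 (by
        rintro rfl
        rcases h with rfl | rfl
        · exact hx.ne' ha
        · rw [hf.odd, ha, neg_zero] at hx
          exact lt_irrefl _ hx)
      have htp := hpos t ⟨hta, ht.2⟩
      rcases h with rfl | rfl
      · exact ⟨t, ⟨hta, ht.2⟩, rfl⟩
      · rw [hf.odd] at hx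
        linarith
    · rintro ⟨t, ht, rfl⟩
      exact ⟨hpos t ht, hg.apply_curve t⟩
  rw [himg]
  exact ⟨isPreconnected_Ioo.image d hg.continuous_curve.continuousOn,
    (Set.nonempty_Ioo.2 (by linarith)).image d⟩

/-- Two pseudolines that meet once cut the sphere into connected regions. -/
theorem isPreconnected_pos_pos (hf : IsEquation L f c) (hg : IsEquation M g d)
    (hLM : ∃! p, p ∈ L ∩ M) :
    IsPreconnected {x | 0 < f x ∧ 0 < g x} ∧ {x | 0 < f x ∧ 0 < g x}.Nonempty := by
  obtain ⟨hN, hNne⟩ := isPreconnected_arc hf hg hLM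
  set N := {x | 0 < f x ∧ g x = 0}
  set Q := {x | 0 < f x ∧ 0 < g x} with hQ
  have hfo : IsOpen {x | 0 < f x} := isOpen_lt continuous_const hf.continuous
  have hgo : IsOpen {x | 0 < g x} := isOpen_lt continuous_const hg.continuous
  have hgo' : IsOpen {x | g x < 0} := isOpen_lt hg.continuous continuous_const
  have hQo : IsOpen Q := hfo.inter hgo
  have hloc : ∀ x ∈ N, ∀ U ∈ 𝓝 x, ∃ V ∈ 𝓝 x, V ⊆ U ∧ IsPreconnected (V ∩ Q) ∧
      (V ∩ Q).Nonempty := by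
    intro x hx U hU
    obtain ⟨V, hV, hVU, hc, hne⟩ := hg.exists_nhds x hx.2 (U ∩ {x | 0 < f x})
      (Filter.inter_mem hU (hfo.mem_nhds hx.1))
    have hVQ : V ∩ {x | 0 < g x} = V ∩ Q := by
      ext y
      exact ⟨fun h => ⟨h.1, (hVU h.1).2, h.2⟩, fun h => ⟨h.1, h.2.2⟩⟩
    rw [hVQ] at hc hne
    exact ⟨V, hV, fun y hy => (hVU hy).1, hc, hne⟩
  -- Points near which $Q$ lies entirely in $u$. If $u, v$ separate $Q$, local connectedness of $Q$
  -- along the arc $N$ puts each point of $N$ in just one of `nearby u` and `nearby v`, and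
  -- connectedness of $N$ makes the choice uniform.
  let nearby : Set Sphere → Set Sphere := fun u => interior {y | y ∈ Q → y ∈ u}
  have key : ∀ u v : Set Sphere, IsOpen u → IsOpen v → Q ⊆ u ∪ v → Q ∩ (u ∩ v) = ∅ →
      N ⊆ nearby u → Q ⊆ u := by
    intro u v hu hv huv hdis hNu
    -- Once $N$ is on the side of $u$, gluing $g < 0$, a neighbourhood of $N$ and $Q \cap u$ leaves
    -- $Q \cap v$ as an open and closed part of the connected set $f > 0$. It misses $N$, hence is
    -- empty.
    have hdisj : {x | 0 < f x} ∩ ((Q ∩ v) ∩ ({x | g x < 0} ∪ nearby u ∪ Q ∩ u)) = ∅ := by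
      rw [Set.eq_empty_iff_forall_notMem]
      rintro x ⟨-, ⟨hxQ, hxv⟩, (hx | hx) | hx⟩
      · exact lt_asymm hx hxQ.2
      · exact hdis.subset ⟨hxQ, interior_subset hx hxQ, hxv⟩
      · exact hdis.subset ⟨hxQ, hx.2, hxv⟩
    have hcover : {x | 0 < f x} ⊆ (Q ∩ v) ∪ ({x | g x < 0} ∪ nearby u ∪ Q ∩ u) := by
      intro x hx
      rcases lt_trichotomy (g x) 0 with h | h | h
      · exact Or.inr (Or.inl (Or.inl h))
      · exact Or.inr (Or.inl (Or.inr (hNu ⟨hx, h⟩)))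
      · rcases huv ⟨hx, h⟩ with hxu | hxv
        · exact Or.inr (Or.inr ⟨⟨hx, h⟩, hxu⟩)
        · exact Or.inl ⟨⟨hx, h⟩, hxv⟩
    rcases isPreconnected_iff_subset_of_disjoint.1 hf.isPreconnected_pos _ _ (hQo.inter hv)
      ((hgo'.union isOpen_interior).union (hQo.inter hu)) hcover hdisj with h | h
    · obtain ⟨x, hx⟩ := hNne
      exact absurd hx.2 (h hx.1).1.2.ne'
    · intro x hx
      rcases huv hx with hxu | hxv
      · exact hxu
      · exact absurd ⟨hx.1, ⟨hx, hxv⟩, h hx.1⟩ (Set.eq_empty_iff_forall_notMem.1 hdisj x)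
  constructor
  · rw [isPreconnected_iff_subset_of_disjoint]
    intro u v hu hv huv hdis
    have hNcover : N ⊆ nearby u ∪ nearby v := by
      intro x hx
      obtain ⟨V, hV, -, hc, -⟩ := hloc x hx Set.univ Filter.univ_mem
      rcases isPreconnected_iff_subset_of_disjoint.1 hc u v hu hv
        (Set.inter_subset_right.trans huv) (Set.subset_eq_empty
          (Set.inter_subset_inter_left _ Set.inter_subset_right) hdis) with h | h
      · exact Or.inl (mem_interior_iff_mem_nhds.2
          (Filter.mem_of_superset hV fun y hy hyQ => h ⟨hy, hyQ⟩))
      · exact Or.inr (mem_interior_iff_mem_nhds.2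
          (Filter.mem_of_superset hV fun y hy hyQ => h ⟨hy, hyQ⟩))
    have hNdis : N ∩ (nearby u ∩ nearby v) = ∅ := by
      rw [Set.eq_empty_iff_forall_notMem]
      rintro x ⟨hx, hxu, hxv⟩
      obtain ⟨V, -, hVU, -, y, hyV, hyQ⟩ := hloc x hx _
        (Filter.inter_mem (isOpen_interior.mem_nhds hxu) (isOpen_interior.mem_nhds hxv))
      exact hdis.subset
        ⟨hyQ, interior_subset (hVU hyV).1 hyQ, interior_subset (hVU hyV).2 hyQ⟩
    rcases isPreconnected_iff_subset_of_disjoint.1 hN _ _ isOpen_interior isOpen_interior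
      hNcover hNdis with h | h
    · exact Or.inl (key u v hu hv huv hdis h)
    · exact Or.inr (key v u hv hu (by rwa [Set.union_comm]) (by rwa [Set.inter_comm v]) h)
  · obtain ⟨x, hx⟩ := hNne
    obtain ⟨V, -, -, -, hne⟩ := hloc x hx Set.univ Filter.univ_mem
    exact hne.mono Set.inter_subset_right

end IsEquation

/-! ### Digons as sign regions. -/

/-- The region of the projective plane in which the odd functions `f` and `g` have opposite
signs. -/
def oppositeRegion (f g : Sphere → ℝ) : Set RP2 := toRP2 '' {x | f x * g x < 0}

theorem toRP2_mem_oppositeRegion {f g : Sphere → ℝ} (hf : ∀ x, f (-x) = -f x)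
    (hg : ∀ x, g (-x) = -g x) (x : Sphere) : toRP2 x ∈ oppositeRegion f g ↔ f x * g x < 0 := by
  constructor
  · rintro ⟨y, hy, hyx⟩
    rcases toRP2_eq_iff.1 hyx with rfl | rfl
    · exact hy
    · simpa [hf, hg] using hy
  · exact fun h => ⟨x, h, rfl⟩

theorem oppositeRegion_comm (f g : Sphere → ℝ) : oppositeRegion f g = oppositeRegion g f := by
  simp only [oppositeRegion, mul_comm]

namespace IsEquation

variable {L M N S : Set RP2} {f g k h : Sphere → ℝ} {c d e r : ℝ → Sphere}

theorem isOpen_oppositeRegion (hf : IsEquation L f c) (hg : IsEquation M g d) :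
    IsOpen (oppositeRegion f g) :=
  isCoveringMap_toRP2.isOpenMap _ (isOpen_lt (hf.continuous.mul hg.continuous) continuous_const)

/-- Upstairs the region splits into two antipodal pieces with the same image, so a single piece,
connected by `isPreconnected_pos_pos` for $f$ and $-g$, suffices. -/
theorem isConnected_oppositeRegion (hf : IsEquation L f c) (hg : IsEquation M g d)
    (hLM : ∃! p, p ∈ L ∩ M) : IsConnected (oppositeRegion f g) := by
  have h := isPreconnected_pos_pos hf hg.neg hLM
  have himg : oppositeRegion f g = toRP2 '' {x | 0 < f x ∧ 0 < -g x} := by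
    ext p
    constructor
    · rintro ⟨x, hx, rfl⟩
      rcases mul_neg_iff.1 (show f x * g x < 0 from hx) with hx | hx
      · exact ⟨x, ⟨hx.1, neg_pos.2 hx.2⟩, rfl⟩
      · refine ⟨-x, ⟨?_, ?_⟩, toRP2_neg x⟩
        · rw [hf.odd]; linarith
        · rw [hg.odd]; linarith
    · rintro ⟨x, hx, rfl⟩
      exact ⟨x, mul_neg_of_pos_of_neg hx.1 (neg_pos.1 hx.2), rfl⟩
  rw [himg]
  exact ⟨h.2.image _, h.1.image _ continuous_toRP2.continuousOn⟩

theorem compl_union_eq (hf : IsEquation L f c) (hg : IsEquation M g d) :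
    (L ∪ M)ᶜ = oppositeRegion f g ∪ oppositeRegion f (fun x => -g x) := by
  ext p
  obtain ⟨x, rfl⟩ := toRP2_surjective p
  rw [Set.mem_union, toRP2_mem_oppositeRegion hf.odd hg.odd,
    toRP2_mem_oppositeRegion hf.odd hg.neg.odd, Set.mem_compl_iff, Set.mem_union, hf.mem_iff,
    hg.mem_iff, ← mul_eq_zero, mul_neg, neg_lt_zero]
  exact ne_iff_lt_or_gt

theorem disjoint_oppositeRegion (hf : IsEquation L f c) (hg : IsEquation M g d) :
    Disjoint (oppositeRegion f g) (oppositeRegion f (fun x => -g x)) := by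
  rw [Set.disjoint_left]
  intro p hp hp'
  obtain ⟨x, rfl⟩ := toRP2_surjective p
  rw [toRP2_mem_oppositeRegion hf.odd hg.odd] at hp
  rw [toRP2_mem_oppositeRegion hf.odd hg.neg.odd] at hp'
  linarith

/-- The digons of two pseudolines are the regions where their equations have opposite, and
equal, signs. -/
theorem digons_eq (hf : IsEquation L f c) (hg : IsEquation M g d) (hLM : ∃! p, p ∈ L ∩ M) :
    digons L M = {oppositeRegion f g, oppositeRegion f (fun x => -g x)} := by
  have h1 := isConnected_oppositeRegion hf hg hLM
  have h2 := isConnected_oppositeRegion hf hg.neg hLM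
  have ho1 := isOpen_oppositeRegion hf hg
  have ho2 := isOpen_oppositeRegion hf hg.neg
  have hd := disjoint_oppositeRegion hf hg
  have hu := compl_union_eq hf hg
  have hc1 : ∀ p ∈ oppositeRegion f g, connectedComponentIn (L ∪ M)ᶜ p = oppositeRegion f g := by
    intro p hp
    refine Set.Subset.antisymm ?_ (h1.isPreconnected.subset_connectedComponentIn hp
      (by rw [hu]; exact Set.subset_union_left))
    refine isPreconnected_connectedComponentIn.subset_left_of_subset_union ho1 ho2 hd
      (hu ▸ connectedComponentIn_subset _ _) ⟨p, mem_connectedComponentIn ?_, hp⟩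
    rw [hu]
    exact Or.inl hp
  have hc2 : ∀ p ∈ oppositeRegion f (fun x => -g x),
      connectedComponentIn (L ∪ M)ᶜ p = oppositeRegion f (fun x => -g x) := by
    intro p hp
    refine Set.Subset.antisymm ?_ (h2.isPreconnected.subset_connectedComponentIn hp
      (by rw [hu]; exact Set.subset_union_right))
    refine isPreconnected_connectedComponentIn.subset_right_of_subset_union ho1 ho2 hd
      (hu ▸ connectedComponentIn_subset _ _) ⟨p, mem_connectedComponentIn ?_, hp⟩
    rw [hu]
    exact Or.inr hp
  ext D
  constructor
  · rintro ⟨p, hp, rfl⟩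
    rw [hu] at hp
    rcases hp with hp | hp
    · exact Or.inl (hc1 p hp)
    · exact Or.inr (hc2 p hp)
  · rintro (rfl | rfl)
    · obtain ⟨p, hp⟩ := h1.nonempty
      exact ⟨p, by rw [hu]; exact Or.inl hp, (hc1 p hp).symm⟩
    · obtain ⟨p, hp⟩ := h2.nonempty
      exact ⟨p, by rw [hu]; exact Or.inr hp, (hc2 p hp).symm⟩

end IsEquation

/-! ### Sign identities modulo 2. -/

open Classical in
/-- The indicator, modulo 2, of the region where `f` and `g` have opposite signs. -/
noncomputable def oppositeSign (f g : Sphere → ℝ) (p : RP2) : ZMod 2 :=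
  if p ∈ oppositeRegion f g then 1 else 0

theorem oppositeSign_comm (f g : Sphere → ℝ) (p : RP2) :
    oppositeSign f g p = oppositeSign g f p := by
  rw [oppositeSign, oppositeSign, oppositeRegion_comm]

namespace IsEquation

variable {L M N S : Set RP2} {f g k h : Sphere → ℝ} {c d e r : ℝ → Sphere}

open Classical in
theorem oppositeSign_toRP2 (hf : IsEquation L f c) (hg : IsEquation M g d) (x : Sphere) :
    oppositeSign f g (toRP2 x) = if f x * g x < 0 then 1 else 0 := by
  rw [oppositeSign, toRP2_mem_oppositeRegion hf.odd hg.odd]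

theorem oppositeSign_cocycle (hf : IsEquation L f c) (hg : IsEquation M g d)
    (hk : IsEquation N k e) {p : RP2} (hL : p ∉ L) (hM : p ∉ M) (hN : p ∉ N) :
    oppositeSign f g p + oppositeSign g k p + oppositeSign f k p = 0 := by
  obtain ⟨x, rfl⟩ := toRP2_surjective p
  rw [hf.mem_iff] at hL
  rw [hg.mem_iff] at hM
  rw [hk.mem_iff] at hN
  rw [oppositeSign_toRP2 hf hg, oppositeSign_toRP2 hg hk, oppositeSign_toRP2 hf hk]
  rcases lt_or_gt_of_ne hL with h1 | h1 <;> rcases lt_or_gt_of_ne hM with h2 | h2 <;>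
    rcases lt_or_gt_of_ne hN with h3 | h3 <;>
    simp [mul_neg_iff, h1, h2, h3, h1.le, h2.le, h3.le, not_lt.2, CharTwo.add_self_eq_zero]

end IsEquation

theorem sum_indicator_of_mul_neg {u v w : ℝ} (h : u * v * w < 0) :
    ((if u < 0 then 1 else 0) + (if v < 0 then 1 else 0) + (if w < 0 then 1 else 0) : ZMod 2)
      = 1 := by
  have hu : u ≠ 0 := by rintro rfl; simp at h
  have hv : v ≠ 0 := by rintro rfl; simp at h
  have hw : w ≠ 0 := by rintro rfl; simp at h
  rcases lt_or_gt_of_ne hu with h1 | h1 <;> rcases lt_or_gt_of_ne hv with h2 | h2 <;>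
    rcases lt_or_gt_of_ne hw with h3 | h3
  · simp [h1, h2, h3, CharTwo.add_self_eq_zero]
  · exact absurd h (not_lt.2 (mul_pos (mul_pos_of_neg_of_neg h1 h2) h3).le)
  · exact absurd h (not_lt.2 (mul_pos_of_neg_of_neg (mul_neg_of_neg_of_pos h1 h2) h3).le)
  · simp [h1, h2.le, h3.le, not_lt.2]
  · exact absurd h (not_lt.2 (mul_pos_of_neg_of_neg (mul_neg_of_pos_of_neg h1 h2) h3).le)
  · simp [h1.le, h2, h3.le, not_lt.2]
  · simp [h1.le, h2.le, h3, not_lt.2]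
  · exact absurd h (not_lt.2 (mul_pos (mul_pos h1 h2) h3).le)

namespace IsEquation

variable {L M N S : Set RP2} {f g k h : Sphere → ℝ} {c d e r : ℝ → Sphere}

/-- Each of $f, g, k$ keeps its sign along the arc of $S$ between the crossings with the other two
pseudolines. For $g$ that arc runs from $t_3$ to $t_1 + \pi$, the antipode of $t_1$, and oddness
supplies the one minus sign. So $fg$ at $t_3$, $gk$ at $t_1$ and $fk$ at $t_2$ have negative
product. -/
theorem oppositeSign_sum_of_lt (hf : IsEquation L f c) (hg : IsEquation M g d)
    (hk : IsEquation N k e) (hS : IsEquation S h r) (hLS : ∃! p, p ∈ L ∩ S)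
    (hMS : ∃! p, p ∈ M ∩ S) (hNS : ∃! p, p ∈ N ∩ S) {t₁ t₂ t₃ : ℝ} (h₁ : f (r t₁) = 0)
    (h₂ : g (r t₂) = 0) (h₃ : k (r t₃) = 0) (h₁₂ : t₁ < t₂) (h₂₃ : t₂ < t₃)
    (h₃₁ : t₃ < t₁ + Real.pi) :
    oppositeSign f g (toRP2 (r t₃)) + oppositeSign g k (toRP2 (r t₁)) +
      oppositeSign f k (toRP2 (r t₂)) = 1 := by
  have e1 : 0 < f (r t₂) * f (r t₃) :=
    mul_pos_of_forall_ne_zero (F := fun t => f (r t)) (hf.continuous.comp hS.continuous_curve)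
      h₂₃.le fun t ht => apply_curve_ne_zero hf hS hLS h₁ (by linarith [ht.1])
        (by rw [abs_lt]; constructor <;> linarith [ht.1, ht.2])
  have e2 : 0 < g (r t₃) * g (r (t₁ + Real.pi)) :=
    mul_pos_of_forall_ne_zero (F := fun t => g (r t)) (hg.continuous.comp hS.continuous_curve)
      h₃₁.le fun t ht => apply_curve_ne_zero hg hS hMS h₂ (by linarith [ht.1])
        (by rw [abs_lt]; constructor <;> linarith [ht.1, ht.2])
  have e3 : 0 < k (r t₁) * k (r t₂) :=
    mul_pos_of_forall_ne_zero (F := fun t => k (r t)) (hk.continuous.comp hS.continuous_curve)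
      h₁₂.le fun t ht => apply_curve_ne_zero hk hS hNS h₃ (by linarith [ht.2])
        (by rw [abs_lt]; constructor <;> linarith [ht.1, ht.2])
  rw [hS.curve_add_pi, hg.odd] at e2
  rw [oppositeSign_toRP2 hf hg, oppositeSign_toRP2 hg hk, oppositeSign_toRP2 hf hk]
  apply sum_indicator_of_mul_neg
  have := mul_pos (mul_pos e1 e2) e3
  nlinarith [this]

/-- Three pseudolines cut a fourth one in three points: the number of these points at which the
other two pseudolines have opposite signs is odd. -/
theorem oppositeSign_sum_eq_one (hf : IsEquation L f c) (hg : IsEquation M g d)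
    (hk : IsEquation N k e) (hS : IsEquation S h r) (hLS : ∃! p, p ∈ L ∩ S)
    (hMS : ∃! p, p ∈ M ∩ S) (hNS : ∃! p, p ∈ N ∩ S) {p₁ p₂ p₃ : RP2} (h₁ : p₁ ∈ L ∩ S)
    (h₂ : p₂ ∈ M ∩ S) (h₃ : p₃ ∈ N ∩ S) (h₁₂ : p₁ ≠ p₂) (h₁₃ : p₁ ≠ p₃) (h₂₃ : p₂ ≠ p₃) :
    oppositeSign f g p₃ + oppositeSign g k p₁ + oppositeSign f k p₂ = 1 := by
  obtain ⟨x, rfl⟩ := toRP2_surjective p₁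
  obtain ⟨t₁, rfl⟩ := hS.exists_curve_eq x ((hS.mem_iff x).1 h₁.2)
  have hpar : ∀ p ∈ S, p ≠ toRP2 (r t₁) → ∃ t, p = toRP2 (r t) ∧ t₁ < t ∧ t < t₁ + Real.pi := by
    intro p hp hne
    obtain ⟨y, rfl⟩ := toRP2_surjective p
    obtain ⟨t, ht, hy⟩ := hS.exists_mem_Ico y ((hS.mem_iff y).1 hp) t₁
    have hy' : toRP2 y = toRP2 (r t) := toRP2_eq_iff.2 hy
    refine ⟨t, hy', lt_of_le_of_ne ht.1 ?_, ht.2⟩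
    rintro rfl
    exact hne hy'
  obtain ⟨t₂, rfl, h2, h2'⟩ := hpar p₂ h₂.2 h₁₂.symm
  obtain ⟨t₃, rfl, h3, h3'⟩ := hpar p₃ h₃.2 h₁₃.symm
  have z1 := (hf.mem_iff _).1 h₁.1
  have z2 := (hg.mem_iff _).1 h₂.1
  have z3 := (hk.mem_iff _).1 h₃.1
  rcases lt_trichotomy t₂ t₃ with h | rfl | h
  · exact oppositeSign_sum_of_lt hf hg hk hS hLS hMS hNS z1 z2 z3 h2 h h3'
  · exact absurd rfl h₂₃
  -- The reverse order reduces to the previous one, since the sum is symmetric in $M$ and $N$.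
  · have := oppositeSign_sum_of_lt hf hk hg hS hLS hNS hMS z1 z3 z2 h3 h h2'
    rw [oppositeSign_comm g k, ← this]
    ring

end IsEquation

/-! ### Crossings indexed by pairs of pseudolines. -/

open Finset

/-- `P` assigns to each pair of distinct pseudolines of `A` their crossing. -/
def IsCrossingMap (A : Finset (Set RP2)) (P : Finset (Set RP2) → RP2) : Prop :=
  ∀ e ∈ A.powersetCard 2, ∀ S ∈ e, P e ∈ S

theorem mem_powersetCard_two {α : Type*} [DecidableEq α] {A e : Finset α} :
    e ∈ A.powersetCard 2 ↔ ∃ S ∈ A, ∃ T ∈ A, S ≠ T ∧ e = {S, T} := by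
  rw [mem_powersetCard, card_eq_two]
  constructor
  · rintro ⟨h, S, T, hST, rfl⟩
    exact ⟨S, h (by simp), T, h (by simp), hST, rfl⟩
  · rintro ⟨S, hS, T, hT, hST, rfl⟩
    exact ⟨by simp [insert_subset_iff, hS, hT], S, T, hST, rfl⟩

variable {A : Finset (Set RP2)} {P : Finset (Set RP2) → RP2}

theorem IsSimpleArrangement.exists_isCrossingMap (hA : IsSimpleArrangement A) :
    ∃ P, IsCrossingMap A P := by
  classical
  have h : ∀ e : Finset (Set RP2), ∃ p, e ∈ A.powersetCard 2 → ∀ S ∈ e, p ∈ S := by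
    intro e
    by_cases he : e ∈ A.powersetCard 2
    · obtain ⟨S, hS, T, hT, hST, rfl⟩ := mem_powersetCard_two.1 he
      obtain ⟨p, hp, -⟩ := hA.meet_once S hS T hT hST
      exact ⟨p, fun _ => by simpa using hp⟩
    · exact ⟨Projectivization.mk ℝ _ (insertNth_one_ne_zero 0 0), fun h => absurd h he⟩
  choose P hP using h
  exact ⟨P, hP⟩

theorem IsCrossingMap.pair_mem [DecidableEq (Set RP2)] (hP : IsCrossingMap A P) {S T : Set RP2}
    (hS : S ∈ A) (hT : T ∈ A) (hST : S ≠ T) : P {S, T} ∈ S ∩ T := by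
  have h := hP _ (mem_powersetCard_two.2 ⟨S, hS, T, hT, hST, rfl⟩)
  exact ⟨h S (by simp), h T (by simp)⟩

theorem IsCrossingMap.notMem (hP : IsCrossingMap A P) (hA : IsSimpleArrangement A)
    {e : Finset (Set RP2)} (he : e ∈ A.powersetCard 2) {L : Set RP2} (hL : L ∈ A) (hLe : L ∉ e) :
    P e ∉ L := by
  classical
  intro hp
  obtain ⟨S, hS, T, hT, hST, rfl⟩ := mem_powersetCard_two.1 he
  simp only [mem_insert, mem_singleton, not_or] at hLe
  have h := hP.pair_mem hS hT hST
  exact (hA.no_triple S hS T hT L hL hST (Ne.symm hLe.1) (Ne.symm hLe.2)).subset ⟨h, hp⟩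

/-- If two pairs shared their crossing, a member of one outside the other would pass through a
triple point. Counting points thus becomes counting pairs. -/
theorem IsCrossingMap.injOn (hP : IsCrossingMap A P) (hA : IsSimpleArrangement A) :
    Set.InjOn P (A.powersetCard 2) := by
  intro e he e' he' h
  refine (eq_of_subset_of_card_le (fun S hS => ?_) ?_).symm
  · by_contra hSe
    exact hP.notMem hA he ((mem_powersetCard.1 he').1 hS) hSe (h ▸ hP e' he' S hS)
  · rw [(mem_powersetCard.1 he).2, (mem_powersetCard.1 he').2]

open Classical in
theorem IsCrossingMap.crossings_eq (hP : IsCrossingMap A P) (hA : IsSimpleArrangement A)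
    (L M D : Set RP2) :
    crossings A L M D = #{e ∈ (A \ {L, M}).powersetCard 2 | P e ∈ D} := by
  have hsub : (A \ {L, M}).powersetCard 2 ⊆ A.powersetCard 2 :=
    powersetCard_mono sdiff_subset
  rw [← card_image_of_injOn ((hP.injOn hA).mono
    (coe_subset.2 ((filter_subset _ _).trans hsub))), ← Set.ncard_coe_finset, crossings]
  congr 1
  ext p
  simp only [Set.mem_ofPred_eq, coe_image, coe_filter, Set.mem_image]
  constructor
  · rintro ⟨hp, S, hS, T, hT, hST, hSL, hSM, hTL, hTM, hpST⟩
    have hpe : P {S, T} = p :=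
      (hA.meet_once S hS T hT hST).unique (hP.pair_mem hS hT hST) hpST
    refine ⟨{S, T}, ⟨mem_powersetCard_two.2 ⟨S, ?_, T, ?_, hST, rfl⟩, hpe ▸ hp⟩, hpe⟩
    · simp [hS, hSL, hSM]
    · simp [hT, hTL, hTM]
  · rintro ⟨e, ⟨he, heD⟩, rfl⟩
    obtain ⟨S, hS, T, hT, hST, rfl⟩ := mem_powersetCard_two.1 he
    simp only [mem_sdiff, mem_insert, mem_singleton, not_or] at hS hT
    exact ⟨heD, S, hS.1, T, hT.1, hST, hS.2.1, hS.2.2, hT.2.1, hT.2.2,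
      hP.pair_mem hS.1 hT.1 hST⟩

/-! ### Crossing parities. -/

variable {f : Set RP2 → Sphere → ℝ} {c : Set RP2 → ℝ → Sphere}

open Classical in
/-- The number, modulo 2, of crossings at which `f L` and `f M` have opposite signs. -/
noncomputable def crossingParity (A : Finset (Set RP2)) (P : Finset (Set RP2) → RP2)
    (f : Set RP2 → Sphere → ℝ) (L M : Set RP2) : ZMod 2 :=
  ∑ e ∈ (A \ {L, M}).powersetCard 2, oppositeSign (f L) (f M) (P e)

theorem IsCrossingMap.cast_crossings_oppositeRegion (hP : IsCrossingMap A P)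
    (hA : IsSimpleArrangement A) (L M : Set RP2) :
    (crossings A L M (oppositeRegion (f L) (f M)) : ZMod 2) = crossingParity A P f L M := by
  classical
  rw [hP.crossings_eq hA, crossingParity, natCast_card_filter]
  exact sum_congr rfl fun e _ => by rw [oppositeSign]

/-- No crossing of two other pseudolines lies on $L \cup M$, so each lies in exactly one of the two
sign regions. -/
theorem IsCrossingMap.crossings_add (hP : IsCrossingMap A P)
    (hA : IsSimpleArrangement A) (hf : ∀ L ∈ A, IsEquation L (f L) (c L)) {L M : Set RP2}
    (hL : L ∈ A) (hM : M ∈ A) (hLM : L ≠ M) :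
    crossings A L M (oppositeRegion (f L) (f M)) +
      crossings A L M (oppositeRegion (f L) fun x => -f M x) = (#A - 2).choose 2 := by
  classical
  have hcard : #(A \ {L, M}) = #A - 2 := by
    rw [card_sdiff_of_subset (by simp [insert_subset_iff, hL, hM]), card_pair hLM]
  rw [hP.crossings_eq hA, hP.crossings_eq hA, ← hcard, ← card_powersetCard,
    ← card_filter_add_card_filter_not (s := (A \ {L, M}).powersetCard 2)
      (fun e => P e ∈ oppositeRegion (f L) (f M))]
  congr 2
  refine filter_congr fun e he => ?_
  have he' := powersetCard_mono sdiff_subset he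
  have hmem : P e ∈ (L ∪ M)ᶜ := by
    rintro (h | h)
    · exact hP.notMem hA he' hL (fun h => by simpa using (mem_powersetCard.1 he).1 h) h
    · exact hP.notMem hA he' hM (fun h => by simpa using (mem_powersetCard.1 he).1 h) h
  rw [(hf L hL).compl_union_eq (hf M hM)] at hmem
  exact ⟨fun h h' => Set.disjoint_left.1 ((hf L hL).disjoint_oppositeRegion (hf M hM)) h' h,
    hmem.resolve_left⟩

theorem crossingParity_comm (L M : Set RP2) :
    crossingParity A P f L M = crossingParity A P f M L := by
  classical
  rw [crossingParity, crossingParity, pair_comm]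
  simp only [oppositeSign_comm (f L)]

theorem sum_powersetCard_two_insert {α β : Type*} [DecidableEq α] [AddCommMonoid β] {N : α}
    {R : Finset α} (hN : N ∉ R) (w : Finset α → β) :
    ∑ e ∈ (insert N R).powersetCard 2, w e =
      ∑ e ∈ R.powersetCard 2, w e + ∑ S ∈ R, w {N, S} := by
  rw [powersetCard_succ_insert hN, sum_union, sum_image, powersetCard_one, sum_map]
  · rfl
  · intro s hs t ht hst
    have hs' := fun h => hN ((mem_powersetCard.1 hs).1 h)
    have ht' := fun h => hN ((mem_powersetCard.1 ht).1 h)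
    rw [← erase_insert hs', hst, erase_insert ht']
  · rw [disjoint_left]
    intro e he he'
    obtain ⟨s, -, rfl⟩ := mem_image.1 he'
    exact hN ((mem_powersetCard.1 he).1 (mem_insert_self _ _))

/-- The crossing parities of three pseudolines add up to the number of remaining pseudolines. -/
theorem IsCrossingMap.crossingParity_add (hP : IsCrossingMap A P)
    (hA : IsSimpleArrangement A) (hf : ∀ L ∈ A, IsEquation L (f L) (c L)) {L M N : Set RP2}
    (hL : L ∈ A) (hM : M ∈ A) (hN : N ∈ A) (hLM : L ≠ M) (hLN : L ≠ N) (hMN : M ≠ N) :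
    crossingParity A P f L M + crossingParity A P f M N + crossingParity A P f L N =
      ((#A - 3 : ℕ) : ZMod 2) := by
  classical
  set R := A \ {L, M, N} with hR
  have hRmem : ∀ S, S ∈ R ↔ S ∈ A ∧ S ≠ L ∧ S ≠ M ∧ S ≠ N := fun S => by simp [hR]
  have hcard : #R = #A - 3 := by
    rw [hR, card_sdiff_of_subset (by simp [insert_subset_iff, hL, hM, hN]),
      card_eq_three.2 ⟨L, M, N, hLM, hLN, hMN, rfl⟩]
  have h1 : A \ {L, M} = insert N R := by
    ext S
    simp only [mem_sdiff, mem_insert, mem_singleton, hRmem]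
    by_cases h : S = N
    · subst h; simp [hN, hLN.symm, hMN.symm]
    · simp [h]
  have h2 : A \ {M, N} = insert L R := by
    ext S
    simp only [mem_sdiff, mem_insert, mem_singleton, hRmem]
    by_cases h : S = L
    · subst h; simp [hL, hLN, hLM]
    · simp [h]
  have h3 : A \ {L, N} = insert M R := by
    ext S
    simp only [mem_sdiff, mem_insert, mem_singleton, hRmem]
    by_cases h : S = M
    · subst h; simp [hM, hLM.symm, hMN]
    · simp [h]
  -- Each sum splits into pairs inside $R$ and pairs joining the third pseudoline to some $S \in R$.
  -- The latter are regrouped by $S$ in `hout`.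
  rw [crossingParity, crossingParity, crossingParity, h1, h2, h3,
    sum_powersetCard_two_insert (by simp [hRmem]), sum_powersetCard_two_insert (by simp [hRmem]),
    sum_powersetCard_two_insert (by simp [hRmem]), ← hcard]
  have hin : ∑ e ∈ R.powersetCard 2, (oppositeSign (f L) (f M) (P e) +
      oppositeSign (f M) (f N) (P e) + oppositeSign (f L) (f N) (P e)) = 0 := by
    refine sum_eq_zero fun e he => ?_
    have he' := powersetCard_mono sdiff_subset he
    have hne : ∀ K, K ∉ R → K ∉ e := fun K hK h => hK ((mem_powersetCard.1 he).1 h)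
    exact (hf L hL).oppositeSign_cocycle (hf M hM) (hf N hN)
      (hP.notMem hA he' hL (hne L (by simp [hRmem])))
      (hP.notMem hA he' hM (hne M (by simp [hRmem])))
      (hP.notMem hA he' hN (hne N (by simp [hRmem])))
  have hout : ∑ S ∈ R, (oppositeSign (f L) (f M) (P {N, S}) +
      oppositeSign (f M) (f N) (P {L, S}) + oppositeSign (f L) (f N) (P {M, S})) = #R := by
    rw [card_eq_sum_ones, Nat.cast_sum]
    refine sum_congr rfl fun S hS => ?_
    obtain ⟨hSA, hSL, hSM, hSN⟩ := (hRmem S).1 hS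
    have hp := hP.pair_mem hL hSA hSL.symm
    have hq := hP.pair_mem hM hSA hSM.symm
    have hr := hP.pair_mem hN hSA hSN.symm
    have hno : ∀ K ∈ A, ∀ K' ∈ A, K ≠ K' → S ≠ K → S ≠ K' → P {K, S} ∈ K ∩ S →
        P {K', S} ∈ K' ∩ S → P {K, S} ≠ P {K', S} := fun K hK K' hK' hKK' hSK hSK' h h' he =>
      (hA.no_triple K hK K' hK' S hSA hKK' hSK.symm hSK'.symm).subset
        ⟨⟨h.1, he ▸ h'.1⟩, h.2⟩
    simpa using (hf L hL).oppositeSign_sum_eq_one (hf M hM) (hf N hN) (hf S hSA)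
      (hA.meet_once L hL S hSA hSL.symm) (hA.meet_once M hM S hSA hSM.symm)
      (hA.meet_once N hN S hSA hSN.symm) hp hq hr
      (hno L hL M hM hLM hSL hSM hp hq) (hno L hL N hN hLN hSL hSN hp hr)
      (hno M hM N hN hMN hSM hSN hq hr)
  simp only [sum_add_distrib] at hin hout
  linear_combination hin + hout

end Pseudolines

/-! ### The equivalence relation and its classes. -/

open Pseudolines in
theorem theorem5 (n : ℕ) (A : Finset (Set Pseudolines.RP2)) (hn : A.card = n)
    (hA : Pseudolines.IsSimpleArrangement A) (heven : Even ((n - 2).choose 2)) :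
    -- two distinct pseudolines have exactly two digons, whose numbers of crossings have the
    -- same parity, so that the relation does not depend on the digon used
    (∀ L ∈ A, ∀ M ∈ A, L ≠ M → ∃ D₁ D₂ : Set Pseudolines.RP2, D₁ ≠ D₂ ∧
      Pseudolines.digons L M = {D₁, D₂} ∧
      Pseudolines.crossings A L M D₁ + Pseudolines.crossings A L M D₂ = (n - 2).choose 2 ∧
      Pseudolines.crossings A L M D₁ ≡ Pseudolines.crossings A L M D₂ [MOD 2]) ∧
    -- the relation is an equivalence relation with at most two classes
    ∃ h : Equivalence (Pseudolines.Related A),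
      Nat.card (Quotient (Setoid.mk (Pseudolines.Related A) h)) ≤ 2 := by
  subst hn
  have hex : ∀ L : Set RP2, ∃ f c, L ∈ A → IsEquation L f c := by
    intro L
    by_cases hL : L ∈ A
    · obtain ⟨f, c, h⟩ := (hA.pseudoline L hL).exists_isEquation
      exact ⟨f, c, fun _ => h⟩
    · exact ⟨fun _ => 0, fun _ => radial ⟨_, insertNth_one_ne_zero 0 0⟩, fun h => absurd h hL⟩
  choose f c hf using hex
  obtain ⟨P, hP⟩ := hA.exists_isCrossingMap
  have hdig : ∀ L ∈ A, ∀ M ∈ A, L ≠ M →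
      digons L M = {oppositeRegion (f L) (f M), oppositeRegion (f L) fun x => -f M x} :=
    fun L hL M hM hLM => (hf L hL).digons_eq (hf M hM) (hA.meet_once L hL M hM hLM)
  have hmod : ∀ L ∈ A, ∀ M ∈ A, L ≠ M → crossings A L M (oppositeRegion (f L) (f M)) ≡
      crossings A L M (oppositeRegion (f L) fun x => -f M x) [MOD 2] := by
    intro L hL M hM hLM
    rw [← hP.crossings_add hA hf hL hM hLM, Nat.even_iff] at heven
    show _ % 2 = _ % 2
    omega
  refine ⟨fun L hL M hM hLM => ⟨_, _, ?_, hdig L hL M hM hLM, hP.crossings_add hA hf hL hM hLM,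
    hmod L hL M hM hLM⟩, ?_⟩
  · intro h
    have hd := (hf L hL).disjoint_oppositeRegion (hf M hM)
    rw [← h, disjoint_self] at hd
    exact ((hf L hL).isConnected_oppositeRegion (hf M hM)
      (hA.meet_once L hL M hM hLM)).nonempty.ne_empty hd
  have hrel : ∀ L M : {L : Set RP2 // L ∈ A}, Related A L M ↔ L = M ∨
      crossingParity A P f L M = (((A.card - 3).choose 2 : ℕ) : ZMod 2) := by
    intro L M
    by_cases hLM : L = M
    · exact ⟨fun _ => Or.inl hLM, fun _ => Or.inl hLM⟩
    have hLM' : (L : Set RP2) ≠ M := fun h => hLM (Subtype.ext h)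
    rw [Related, hdig L L.2 M M.2 hLM', ← hP.cast_crossings_oppositeRegion hA,
      ZMod.natCast_eq_natCast_iff]
    -- Both digons give the same parity, so the witness may be taken to be the opposite-sign region.
    refine or_congr_right ⟨?_, fun h => ⟨_, Or.inl rfl, h⟩⟩
    rintro ⟨D, rfl | rfl, h⟩
    · exact h
    · exact (hmod L L.2 M M.2 hLM').trans h
  have hadd : ∀ L M N : {L : Set RP2 // L ∈ A}, L ≠ M → L ≠ N → M ≠ N →
      crossingParity A P f L M + crossingParity A P f M N + crossingParity A P f L N =
        (((A.card - 3).choose 2 : ℕ) : ZMod 2) := by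
    intro L M N hLM hLN hMN
    have hLM' : (L : Set RP2) ≠ M := fun h => hLM (Subtype.ext h)
    have hLN' : (L : Set RP2) ≠ N := fun h => hLN (Subtype.ext h)
    have hMN' : (M : Set RP2) ≠ N := fun h => hMN (Subtype.ext h)
    rw [hP.crossingParity_add hA hf L.2 M.2 N.2 hLM' hLN' hMN', ZMod.natCast_eq_natCast_iff]
    have hcard : 2 < A.card := Finset.two_lt_card.2 ⟨L, L.2, M, M.2, N, N.2, hLM', hLN', hMN'⟩
    -- With $m = n - 3$, Pascal's rule turns the evenness of $\binom{m+1}{2}$ into $m \equiv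
    -- \binom{m}{2}$ modulo $2$.
    obtain ⟨m, hm⟩ : ∃ m, A.card = m + 3 := ⟨A.card - 3, by omega⟩
    rw [hm, Nat.even_iff, show m + 3 - 2 = m + 1 by omega, Nat.choose_succ_succ' m 1,
      Nat.choose_one_right] at heven
    rw [hm, Nat.add_sub_cancel]
    change (m + m.choose 2) % 2 = 0 at heven
    show m % 2 = m.choose 2 % 2
    omega
  have htwo : ∀ x y z w : ZMod 2, x + y + z = w → x = w → y = w → z = w := by decide
  have hpigeon : ∀ x y z w : ZMod 2, x + y + z = w → x = w ∨ y = w ∨ z = w := by decide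
  have heq : Equivalence (Related A) := by
    refine ⟨fun L => Or.inl rfl, ?_, ?_⟩
    · intro L M h
      rw [hrel] at h ⊢
      rwa [crossingParity_comm, eq_comm]
    · intro L M N h h'
      by_cases hLM : L = M
      · rwa [hLM]
      by_cases hMN : M = N
      · rwa [← hMN]
      by_cases hLN : L = N
      · exact Or.inl hLN
      rw [hrel] at h h' ⊢
      exact Or.inr (htwo _ _ _ _ (hadd L M N hLM hLN hMN) (h.resolve_left hLM)
        (h'.resolve_left hMN))
  refine ⟨heq, ?_⟩
  by_contra! hlt
  -- `Nat.card` is $0$ on infinite types, so a value above $2$ already forces finiteness.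
  have := Nat.finite_of_card_ne_zero (by omega : Nat.card (Quotient (Setoid.mk _ heq)) ≠ 0)
  have := Fintype.ofFinite (Quotient (Setoid.mk _ heq))
  rw [Nat.card_eq_fintype_card, Fintype.two_lt_card_iff] at hlt
  obtain ⟨a, b, d, hab, had, hbd⟩ := hlt
  induction a, b using Quotient.inductionOn₂ with | h L M => ?_
  induction d using Quotient.inductionOn with | h N => ?_
  have hne : ∀ L M : {L : Set RP2 // L ∈ A}, Quotient.mk (Setoid.mk _ heq) L ≠ Quotient.mk _ M →
      L ≠ M ∧ crossingParity A P f L M ≠ (((A.card - 3).choose 2 : ℕ) : ZMod 2) := by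
    intro L M h
    have h' : ¬ Related A L M := fun hr => h (Quotient.sound hr)
    rwa [hrel, not_or] at h'
  obtain ⟨hLM, h1⟩ := hne L M hab
  obtain ⟨hLN, h2⟩ := hne L N had
  obtain ⟨hMN, h3⟩ := hne M N hbd
  rcases hpigeon _ _ _ _ (hadd L M N hLM hLN hMN) with h | h | h
  · exact h1 h
  · exact h3 h
  · exact h2 h
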